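/- **Setting.** Let $Z$ be a random data vector with law $P$, $X$ a measurable function of $Z$ (e.g. a sub-vector), $\Theta\subseteq\mathbb R^d$ with $\theta_0\in\Theta$, $\mathcal H$ a set of measurable functions $h$ of $X$ with values in $\mathbb R^\ell$ with $h_0\in\mathcal H$, and $m(z,\theta,\gamma)\in\mathbb R^d$ a measurable moment function of $z$, $\theta\in\mathbb R^d$, $\gamma\in\mathbb R^\ell$, with $\mathbb E[m(Z,\theta_0,h_0(X))\mid X]=0$ a.s. Let $Z_1,Z_2,\dots$ be i.i.d. copies of $Z$ (with corresponding $X_t$); at sample size $n$ the data are $Z_1,\dots,Z_{2n}$. *Sample splitting:* $\hat h\in\mathcal H$ is a measurable function of $Z_{n+1},\dots,Z_{2n}$, and $\hat\theta^{SS}\in\Theta$ solves $\hat M(\theta):=\frac1n\sum_{t=1}^n m(Z_t,\theta,\hat h(X_t))=0$. *$K$-fold cross-fitting* ($K\ge1$ fixed, along those $n$ with $K\mid 2n$): $\{1,\dots,2n\}$ is partitioned into $I_1,\dots,I_K$ of size $2n/K$, $\hat h_k\in\mathcal H$ is a measurable function of $(Z_t)_{t\notin I_k}$, and $\hat\theta^{CF}\in\Theta$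 solves $\hat M(\theta):=\frac1{2n}\sum_{k=1}^K\sum_{t\in I_k}m(Z_t,\theta,\hat h_k(X_t))=0$. **Assumption 1.** Let $D^\alpha m=\nabla_{\gamma_1}^{\alpha_1}\cdots\nabla_{\gamma_\ell}^{\alpha_\ell}m$ for $\alpha\in\mathbb N^\ell$. For a non-empty finite $S\subseteq\mathbb N^\ell$ and $k=\max_{\alpha\in S}\|\alpha\|_1$: 1. $\mathbb E[D^\alpha m(Z,\theta_0,h_0(X))\mid X]=0$ a.s. for all $\alpha\in S$. 2. $\mathbb E[m(Z,\theta,h_0(X))]\ne0$ for all $\theta\in\Theta$, $\theta\neq\theta_0$. 3. $\mathbb E[\nabla_\theta m(Z,\theta_0,h_0(X))]$ is invertible. 4. For each $z$, $m(z,\cdot,\cdot)$ is $k$ times continuously differentiable in $(\theta,\gamma)$. 5. $\mathbb E[\prod_i|\hat h_i(X)-h_{0,i}(X)|^{4\alpha_i}\mid\hat h]\to0$ in probability for all nonzero $\alpha\in S$, where $X$ is independent of $\hat h$. 6. $n^{1/2}\big(\mathbb E[\prod_i|\hat h_i(X)-h_{0,i}(X)|^{2\alpha_i}\mid\hat h]\big)^{1/2}\to0$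 in probability for all nonzero $\alpha\notin S$ with $\|\alpha\|_1\le k+1$. 7. There is $r>0$ such that, with $B_{\theta_0}=\{\theta\in\Theta:\|\theta-\theta_0\|_2\le r\}$ and $B_{h_0}=\{h\in\mathcal H:\mathbb E[\prod_i|h_i(X)-h_{0,i}(X)|^{2\alpha_i}]\le r\ \text{ for all } 1\le\|\alpha\|_1\le k+1\}$, the derivatives below exist and (a) $\mathbb E[\sup_{\theta\in B_{\theta_0}}\|\nabla_\theta m(Z,\theta,h_0(X))\|_F]<\infty$; (b) $\sup_{h\in B_{h_0}}\mathbb E[\sup_{\theta\in B_{\theta_0}}\|\nabla_\gamma\nabla_\theta m(Z,\theta,h(X))\|^2]<\infty$; (c) $\max_{\|\alpha\|_1\le k+1}\sup_{h\in B_{h_0}}\mathbb E[\|D^\alpha m(Z,\theta_0,h(X))\|^4]<\infty$; (d) $\mathbb E[\sup_{\theta\in A,h\in B_{h_0}}\|m(Z,\theta,h(X))\|_2]<\infty$ for every compact $A\subseteq\Theta$; (e) $\sup_{\theta\in A,h\in B_{h_0}}\mathbb E[\|\nabla_\gamma m(Z,\theta,h(X))\|^2]<\infty$ for every compact $A\subseteq\Theta$.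 For cross-fitting, items 5 and 6 are required of each $\hat h_k$ in place of $\hat h$. **Theorem (Consistency).** Suppose that Assumption 1 holds for an estimator ($\hat\theta^{SS}$ or $\hat\theta^{CF}$), and that either $\Theta$ is compact, or $\Theta$ is convex, $\theta_0$ is in the interior of $\Theta$ and, with probability tending to $1$, the empirical moment map $\theta\mapsto\hat M(\theta)$ of that estimator is on $\Theta$ the gradient of a convex function. Then that estimator is consistent: $\hat\theta^{SS}\to\theta_0$ in probability, respectively $\hat\theta^{CF}\to\theta_0$ in probability. -/

import Mathlib

open MeasureTheory ProbabilityTheory Filter Topology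
open scoped ENNReal NNReal

namespace OrthogonalML

noncomputable section

/-- The Euclidean space `ℝⁿ`. -/
abbrev Vec (n : ℕ) : Type := EuclideanSpace ℝ (Fin n)

/-- Outer expectation of a nonnegative, possibly non-measurable function (used for suprema over
uncountable families): the infimum of the integrals of its measurable majorants. It is the usual
expectation on measurable functions. -/
def outerExpect {α : Type*} [MeasurableSpace α] (P : Measure α) (f : α → ℝ≥0∞) : ℝ≥0∞ :=
  ⨅ g : α → ℝ≥0∞, ⨅ _ : Measurable g, ⨅ _ : ∀ a, f a ≤ g a, ∫⁻ a, g a ∂P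

/-- Convergence to zero in probability, along the filter `l`, of nonnegative extended-real
random quantities. -/
def ToProbZero {Ω : Type*} [MeasurableSpace Ω] (μ : Measure Ω) (l : Filter ℕ)
    (Y : ℕ → Ω → ℝ≥0∞) : Prop :=
  ∀ ε : ℝ≥0∞, 0 < ε → Tendsto (fun n => μ {ω | ε ≤ Y n ω}) l (𝓝 0)

/-! ### Differentials -/

/-- The partial derivative in the `i`-th coordinate. -/
def partialDeriv {d l : ℕ} (i : Fin l) (f : Vec l → Vec d) : Vec l → Vec d :=
  fun γ => lineDeriv ℝ f γ (EuclideanSpace.single i 1)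

/-- `D^α f = ∇₁^{α₁} ∇₂^{α₂} ⋯ ∇ₗ^{αₗ} f`. -/
def multiDeriv {d l : ℕ} (α : Fin l → ℕ) (f : Vec l → Vec d) : Vec l → Vec d :=
  (List.finRange l).foldr (fun i g => (partialDeriv i)^[α i] g) f

/-- The length `‖α‖₁` of a multi-index. -/
def absIndex {l : ℕ} (α : Fin l → ℕ) : ℕ := ∑ i, α i

/-- `k = max_{α ∈ S} ‖α‖₁`. -/
def maxOrder {l : ℕ} (S : Finset (Fin l → ℕ)) : ℕ := S.sup absIndex

/-- Jacobian matrix: the `(i, j)` entry is `∂ f_i / ∂ θ_j`. -/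
def jacobian {d : ℕ} (f : Vec d → Vec d) (θ : Vec d) : Matrix (Fin d) (Fin d) ℝ :=
  Matrix.of fun i j => (fderiv ℝ f θ (EuclideanSpace.single j 1)) i

/-- Frobenius norm of a matrix. -/
def frobeniusNorm {d : ℕ} (A : Matrix (Fin d) (Fin d) ℝ) : ℝ := √(∑ i, ∑ j, A i j ^ 2)

/-! ### The moment model -/

/-- The estimation problem: the law `P` of the data `Z`, the covariates `X` as a function of the
data, the parameter set `Θ`, the class `H` of nuisance functions, the moments `m z θ γ`, and the
true values `θ₀`, `h₀`, which satisfy `E[m(Z, θ₀, h₀(X)) | X] = 0` almost surely. -/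
structure Model (𝒵 𝒳 : Type*) [MeasurableSpace 𝒵] [MeasurableSpace 𝒳] (d l : ℕ) where
  P : Measure 𝒵
  isProb : IsProbabilityMeasure P
  X : 𝒵 → 𝒳
  measurable_X : Measurable X
  Θ : Set (Vec d)
  H : Set (𝒳 → Vec l)
  measurable_H : ∀ h ∈ H, Measurable h
  m : 𝒵 → Vec d → Vec l → Vec d
  measurable_m : Measurable fun q : 𝒵 × Vec d × Vec l => m q.1 q.2.1 q.2.2
  θ₀ : Vec d
  θ₀_mem : θ₀ ∈ Θ
  h₀ : 𝒳 → Vec l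
  h₀_mem : h₀ ∈ H
  integrable_moment : Integrable (fun z => m z θ₀ (h₀ (X z))) P
  moment_eq_zero :
    P[fun z => m z θ₀ (h₀ (X z)) | MeasurableSpace.comap X inferInstance] =ᵐ[P] 0

namespace Model

variable {𝒵 𝒳 : Type*} [MeasurableSpace 𝒵] [MeasurableSpace 𝒳] {d l : ℕ}

/-- `E[∏ᵢ |hᵢ(X) - h₀ᵢ(X)|^{c αᵢ}]`. -/
def nuisanceError (M : Model 𝒵 𝒳 d l) (c : ℕ) (α : Fin l → ℕ) (h : 𝒳 → Vec l) : ℝ≥0∞ :=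
  ∫⁻ z, ∏ i, ‖h (M.X z) i - M.h₀ (M.X z) i‖ₑ ^ (c * α i) ∂M.P

/-- `{θ ∈ Θ : ‖θ - θ₀‖₂ ≤ r}`. -/
def thetaBall (M : Model 𝒵 𝒳 d l) (r : ℝ) : Set (Vec d) := {θ ∈ M.Θ | ‖θ - M.θ₀‖ ≤ r}

/-- The functions `h ∈ H` with `E[∏ᵢ |hᵢ(X) - h₀ᵢ(X)|^{2αᵢ}] ≤ r` for all multi-indices `α` with
`1 ≤ ‖α‖₁ ≤ k + 1`. (For `α = 0` the expectation is the constant `1`.) -/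
def nuisanceBall (M : Model 𝒵 𝒳 d l) (k : ℕ) (r : ℝ) : Set (𝒳 → Vec l) :=
  {h ∈ M.H | ∀ α : Fin l → ℕ, α ≠ 0 → absIndex α ≤ k + 1 →
    M.nuisanceError 2 α h ≤ ENNReal.ofReal r}

/-- `S`-orthogonality: `E[D^α m(Z, θ₀, h₀(X)) | X] = 0` almost surely, for all `α ∈ S`. -/
def SOrthogonal (M : Model 𝒵 𝒳 d l) (S : Finset (Fin l → ℕ)) : Prop :=
  ∀ α ∈ S, Integrable (fun z => multiDeriv α (M.m z M.θ₀) (M.h₀ (M.X z))) M.P ∧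
    M.P[fun z => multiDeriv α (M.m z M.θ₀) (M.h₀ (M.X z)) |
      MeasurableSpace.comap M.X inferInstance] =ᵐ[M.P] 0

/-- Regularity of the moments with radius `r`. Each item about derivatives comes with the existence
of the derivatives that it mentions. -/
structure Regularity (M : Model 𝒵 𝒳 d l) (k : ℕ) (r : ℝ) : Prop where
  theta_exists : ∀ z, ∀ θ ∈ M.thetaBall r,
    DifferentiableAt ℝ (fun θ' => M.m z θ' (M.h₀ (M.X z))) θ
  theta_dominated :
    outerExpect M.P (fun z => ⨆ θ ∈ M.thetaBall r,
      ENNReal.ofReal (frobeniusNorm (jacobian (fun θ' => M.m z θ' (M.h₀ (M.X z))) θ))) < ∞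
  gamma_theta_exists : ∀ z, ∀ θ ∈ M.thetaBall r, ∀ γ : Vec l,
    DifferentiableAt ℝ (fun θ' => M.m z θ' γ) θ ∧
      DifferentiableAt ℝ (fun γ' => fderiv ℝ (fun θ' => M.m z θ' γ') θ) γ
  gamma_theta_bounded :
    (⨆ h ∈ M.nuisanceBall k r, outerExpect M.P (fun z => ⨆ θ ∈ M.thetaBall r,
      ‖fderiv ℝ (fun γ' => fderiv ℝ (fun θ' => M.m z θ' γ') θ) (h (M.X z))‖ₑ ^ 2)) < ∞
  multi_exists : ∀ z, ∀ α : Fin l → ℕ, absIndex α ≤ k → ∀ i : Fin l, ∀ γ : Vec l,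
    LineDifferentiableAt ℝ (multiDeriv α (M.m z M.θ₀)) γ (EuclideanSpace.single i 1)
  multi_bounded : ∃ lam : ℝ≥0, ∀ α : Fin l → ℕ, absIndex α ≤ k + 1 → ∀ h ∈ M.nuisanceBall k r,
    ∫⁻ z, ‖multiDeriv α (M.m z M.θ₀) (h (M.X z))‖ₑ ^ 4 ∂M.P ≤ lam
  moment_dominated : ∀ A ⊆ M.Θ, IsCompact A →
    outerExpect M.P (fun z => ⨆ θ ∈ A, ⨆ h ∈ M.nuisanceBall k r, ‖M.m z θ (h (M.X z))‖ₑ) < ∞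
  gamma_exists : ∀ z, ∀ θ ∈ M.Θ, ∀ γ : Vec l, DifferentiableAt ℝ (fun γ' => M.m z θ γ') γ
  gamma_bounded : ∀ A ⊆ M.Θ, IsCompact A →
    (⨆ θ ∈ A, ⨆ h ∈ M.nuisanceBall k r,
      ∫⁻ z, ‖fderiv ℝ (fun γ' => M.m z θ γ') (h (M.X z))‖ₑ ^ 2 ∂M.P) < ∞

/-- The assumptions on the moments: orthogonality, identifiability, non-degeneracy, smoothness
and regularity, with `k = max_{α ∈ S} ‖α‖₁`. -/
structure MomentAssumptions (M : Model 𝒵 𝒳 d l) (S : Finset (Fin l → ℕ)) : Prop where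
  nonempty : S.Nonempty
  orthogonal : M.SOrthogonal S
  identifiable : ∀ θ ∈ M.Θ, θ ≠ M.θ₀ → ∫ z, M.m z θ (M.h₀ (M.X z)) ∂M.P ≠ 0
  nondegenerate :
    IsUnit (Matrix.of fun i j =>
      ∫ z, jacobian (fun θ' => M.m z θ' (M.h₀ (M.X z))) M.θ₀ i j ∂M.P :
        Matrix (Fin d) (Fin d) ℝ)
  smooth : ∀ z, ContDiff ℝ (maxOrder S : ℕ) (fun q : Vec d × Vec l => M.m z q.1 q.2)
  regular : ∃ r : ℝ, 0 < r ∧ M.Regularity (maxOrder S) r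

/-- Consistency and rate of the first stage. Here `hhat n ω` is the estimate of `h₀` at sample
size `n`; since it is fitted on data independent of a fresh draw of `(Z, X)`, conditional
expectations given `hhat` are integrals over that fresh draw alone. Both conditions concern
nonzero multi-indices `α`: for `α = 0` the expectation is the constant `1`. -/
structure FirstStageAssumptions (M : Model 𝒵 𝒳 d l) (S : Finset (Fin l → ℕ))
    {Ω : Type*} [MeasurableSpace Ω] (μ : Measure Ω) (L : Filter ℕ)
    (hhat : ℕ → Ω → 𝒳 → Vec l) : Prop where
  consistency : ∀ α ∈ S, α ≠ 0 → ToProbZero μ L (fun n ω => M.nuisanceError 4 α (hhat n ω))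
  rate : ∀ α : Fin l → ℕ, α ≠ 0 → absIndex α ≤ maxOrder S + 1 → α ∉ S →
    ToProbZero μ L (fun n ω =>
      (n : ℝ≥0∞) ^ (1 / 2 : ℝ) * M.nuisanceError 2 α (hhat n ω) ^ (1 / 2 : ℝ))

/-- `Z 0, Z 1, …` are independent replicates of the data vector. -/
structure IsSample (M : Model 𝒵 𝒳 d l) {Ω : Type*} [MeasurableSpace Ω] (μ : Measure Ω)
    (Z : ℕ → Ω → 𝒵) : Prop where
  measurable : ∀ t, Measurable (Z t)
  indep : iIndepFun Z μ
  law : ∀ t, μ.map (Z t) = M.P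

/-- A first-stage procedure fitted on data indexed by `ι`: it maps every data set to an element of
`H`, measurably in the data and the covariate. -/
structure IsProcedure (M : Model 𝒵 𝒳 d l) {ι : Type*} (g : (ι → 𝒵) → 𝒳 → Vec l) : Prop where
  mem : ∀ w, g w ∈ M.H
  measurable : Measurable fun q : (ι → 𝒵) × 𝒳 => g q.1 q.2

/-- `F` is, on `Θ`, the gradient of a convex function. -/
def IsConvexGradient (Θ : Set (Vec d)) (F : Vec d → Vec d) : Prop :=
  ∃ φ : Vec d → ℝ, ConvexOn ℝ Θ φ ∧ ∀ θ ∈ Θ, HasGradientWithinAt φ (F θ) Θ θ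

/-- The compactness conditions or the convexity conditions, for the (random) empirical moment maps
`F n ω : θ ↦ F n ω θ`. -/
def CompactOrConvex (M : Model 𝒵 𝒳 d l) {Ω : Type*} [MeasurableSpace Ω] (μ : Measure Ω)
    (L : Filter ℕ) (F : ℕ → Ω → Vec d → Vec d) : Prop :=
  IsCompact M.Θ ∨
    (Convex ℝ M.Θ ∧ M.θ₀ ∈ interior M.Θ ∧
      Tendsto (fun n => μ {ω | ¬ IsConvexGradient M.Θ (F n ω)}) L (𝓝 0))

/-! ### Sample splitting -/

/-- The first-stage estimate fitted on the second half `Z n, …, Z (2n - 1)` of the sample. -/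
def ssNuisance {Ω : Type*} (Z : ℕ → Ω → 𝒵) (g : ∀ n : ℕ, (Fin n → 𝒵) → 𝒳 → Vec l)
    (n : ℕ) (ω : Ω) : 𝒳 → Vec l :=
  g n (fun s => Z (n + s) ω)

/-- The empirical moment map `θ ↦ (1/n) ∑ m(Z_t, θ, hhat(X_t))` over the first half
`Z 0, …, Z (n - 1)` of the sample. -/
def ssMoment (M : Model 𝒵 𝒳 d l) {Ω : Type*} (Z : ℕ → Ω → 𝒵)
    (g : ∀ n : ℕ, (Fin n → 𝒵) → 𝒳 → Vec l) (n : ℕ) (ω : Ω) (θ : Vec d) : Vec d :=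
  (1 / (n : ℝ)) • ∑ t : Fin n, M.m (Z t ω) θ (ssNuisance Z g n ω (M.X (Z t ω)))

/-! ### Cross-fitting -/

/-- The sample sizes `n` for which `K` divides `2n`, tending to infinity. -/
def cfFilter (K : ℕ) : Filter ℕ := atTop ⊓ 𝓟 {n | K ∣ 2 * n}

/-- `fold n` splits the `2n` indices into `K` folds of cardinality `2n / K` whenever `K ∣ 2n`. -/
def IsFolding {K : ℕ} (fold : ∀ n : ℕ, Fin (2 * n) → Fin K) : Prop :=
  ∀ n : ℕ, K ∣ 2 * n → ∀ k : Fin K, (Finset.univ.filter fun t => fold n t = k).card = 2 * n / K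

/-- The first-stage estimate for fold `k`, fitted on the data outside fold `k`. -/
def cfNuisance {Ω : Type*} {K : ℕ} (Z : ℕ → Ω → 𝒵) (fold : ∀ n : ℕ, Fin (2 * n) → Fin K)
    (g : ∀ (n : ℕ) (k : Fin K), ({t : Fin (2 * n) // fold n t ≠ k} → 𝒵) → 𝒳 → Vec l)
    (k : Fin K) (n : ℕ) (ω : Ω) : 𝒳 → Vec l :=
  g n k (fun s => Z s.1 ω)

/-- The empirical moment map `θ ↦ (1/(2n)) ∑ₖ ∑_{t ∈ Iₖ} m(Z_t, θ, hhatₖ(X_t))`. -/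
def cfMoment (M : Model 𝒵 𝒳 d l) {Ω : Type*} {K : ℕ} (Z : ℕ → Ω → 𝒵)
    (fold : ∀ n : ℕ, Fin (2 * n) → Fin K)
    (g : ∀ (n : ℕ) (k : Fin K), ({t : Fin (2 * n) // fold n t ≠ k} → 𝒵) → 𝒳 → Vec l)
    (n : ℕ) (ω : Ω) (θ : Vec d) : Vec d :=
  (1 / (2 * (n : ℝ))) • ∑ k : Fin K, ∑ t : Fin (2 * n) with fold n t = k,
    M.m (Z t ω) θ (cfNuisance Z fold g k n ω (M.X (Z t ω)))

end Model

end

end OrthogonalML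

open OrthogonalML OrthogonalML.Model

/-!
Convergence in probability is convergence along a filter (`highProb`), so it can be
handled by composing limits.

A first-stage estimate is independent of the observations it is plugged in at. Given the data it
was fitted on, the expected plug-in error is therefore the value at `ĥ` of an integral which, by
domination, is continuous in `h` at `h₀`. Hence averages with plugged-in nuisance estimates have
the same limit as the averages at `h₀`.

Apply this to the moments as random elements of `C(A, ℝᵈ)` with `A ⊆ Θ` compact: the strong law in
this Banach space makes the empirical moment converge to the population moment uniformly on `A`.
If `Θ` is compact, the zeros converge at once. If the empirical moment is the gradient of a convex
function, it is monotone along cycles of length three, and so is its limit; this forces the zeros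
of the empirical moment into every ball around `θ₀` with compact closure in the interior of `Θ`.
-/

namespace OrthogonalML

open scoped RealInnerProductSpace

section Monotone

lemma add_fderiv_le_of_convexOn {E : Type*} [NormedAddCommGroup E] [NormedSpace ℝ E]
    {s : Set E} {φ : E → ℝ} {φ' : E →L[ℝ] ℝ} {x y : E} (hφ : ConvexOn ℝ s φ)
    (hφ' : HasFDerivWithinAt φ φ' s x) (hx : x ∈ s) (hy : y ∈ s) :
    φ x + φ' (y - x) ≤ φ y := by
  have hline : Set.MapsTo (AffineMap.lineMap x y : ℝ →ᵃ[ℝ] E) (Set.Icc 0 1) s := fun t ht =>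
    hφ.1.segment_subset hx hy (segment_eq_image_lineMap ℝ x y ▸ Set.mem_image_of_mem _ ht)
  have hconv : ConvexOn ℝ (Set.Icc (0 : ℝ) 1) (φ ∘ AffineMap.lineMap x y) :=
    (hφ.comp_affineMap (AffineMap.lineMap x y)).subset hline (convex_Icc 0 1)
  have hderiv : HasDerivWithinAt (φ ∘ AffineMap.lineMap x y) (φ' (y - x)) (Set.Icc 0 1) (0 : ℝ) :=
    HasFDerivWithinAt.comp_hasDerivWithinAt (0 : ℝ) (by simpa using hφ')
      AffineMap.hasDerivWithinAt_lineMap hline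
  have hslope := hconv.le_slope_of_hasDerivWithinAt (by simp) (by simp) zero_lt_one hderiv
  simp only [slope_def_field, Function.comp_apply, AffineMap.lineMap_apply_one,
    AffineMap.lineMap_apply_zero, sub_zero, div_one] at hslope
  linarith

variable {E : Type*} [NormedAddCommGroup E] [InnerProductSpace ℝ E]
  {F G : E → E} {s t : Set E} {θ θ₀ : E}

/-- Cyclic monotonicity of a vector field along the cycles of length three. Gradients of convex
functions have this property, and unlike being such a gradient it passes to pointwise limits. -/
def ThreeCyclicallyMonotoneOn (F : E → E) (s : Set E) : Prop :=
  ∀ x ∈ s, ∀ y ∈ s, ∀ z ∈ s, ⟪F x, y - x⟫ + ⟪F y, z - y⟫ + ⟪F z, x - z⟫ ≤ 0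

namespace ThreeCyclicallyMonotoneOn

lemma mono (hF : ThreeCyclicallyMonotoneOn F t) (hst : s ⊆ t) : ThreeCyclicallyMonotoneOn F s :=
  fun x hx y hy z hz => hF x (hst hx) y (hst hy) z (hst hz)

lemma inner_le_inner (hF : ThreeCyclicallyMonotoneOn F s) {x y : E} (hx : x ∈ s) (hy : y ∈ s) :
    ⟪F x, y - x⟫ ≤ ⟪F y, y - x⟫ := by
  have h := hF x hx y hy x hx
  rw [sub_self, inner_zero_right, ← neg_sub y x, inner_neg_right] at h
  linarith

lemma of_tendsto {ι : Type*} {𝓕 : Filter ι} [𝓕.NeBot] {F : ι → E → E}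
    (hF : ∀ᶠ i in 𝓕, ThreeCyclicallyMonotoneOn (F i) s)
    (hlim : ∀ x ∈ s, Tendsto (fun i => F i x) 𝓕 (𝓝 (G x))) : ThreeCyclicallyMonotoneOn G s :=
  fun x hx y hy z hz => le_of_tendsto
    ((((hlim x hx).inner tendsto_const_nhds).add ((hlim y hy).inner tendsto_const_nhds)).add
      ((hlim z hz).inner tendsto_const_nhds))
    (hF.mono fun _ h => h x hx y hy z hz)

lemma inner_le_inner_of_eq_zero (hG : ThreeCyclicallyMonotoneOn G s) (hθ₀ : θ₀ ∈ s)
    (hzero : G θ₀ = 0) (hθ : θ ∈ s) {z : E} (hz : z ∈ s) :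
    ⟪G θ, z - θ⟫ ≤ ⟪G z, z - θ₀⟫ := by
  have h := hG θ₀ hθ₀ θ hθ z hz
  rw [hzero, inner_zero_left, ← neg_sub z θ₀, inner_neg_right] at h
  linarith

lemma inner_sub_pos (hG : ThreeCyclicallyMonotoneOn G s) (hs : s ∈ 𝓝 θ₀)
    (hcont : ContinuousAt G θ₀) (hzero : G θ₀ = 0) (hθ : θ ∈ s) (hne : G θ ≠ 0) :
    0 < ⟪G θ, θ - θ₀⟫ := by
  by_contra! hle
  have hpath : Tendsto (fun t : ℝ => θ₀ + t • G θ) (𝓝[>] 0) (𝓝 θ₀) := by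
    have hc : Continuous fun t : ℝ => θ₀ + t • G θ := by fun_prop
    simpa using (hc.tendsto 0).mono_left nhdsWithin_le_nhds
  have hlim : Tendsto (fun t : ℝ => ⟪G (θ₀ + t • G θ), G θ⟫) (𝓝[>] 0) (𝓝 0) := by
    simpa [hzero] using (hcont.tendsto.comp hpath).inner (tendsto_const_nhds (x := G θ))
  have hbelow : ∀ᶠ t : ℝ in 𝓝[>] 0, ⟪G θ, G θ⟫ ≤ ⟪G (θ₀ + t • G θ), G θ⟫ := by
    filter_upwards [hpath.eventually hs, self_mem_nhdsWithin] with t ht ht0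
    have h := hG.inner_le_inner_of_eq_zero (mem_of_mem_nhds hs) hzero hθ ht
    have hsplit : θ₀ + t • G θ - θ = t • G θ - (θ - θ₀) := by abel
    rw [hsplit, inner_sub_right, add_sub_cancel_left, inner_smul_right, inner_smul_right] at h
    exact le_of_mul_le_mul_left (by linarith) ht0
  exact hne (real_inner_self_nonpos.mp (ge_of_tendsto hlim hbelow))

lemma dist_lt_of_eq_zero {ε : ℝ} (hF : ThreeCyclicallyMonotoneOn F s) (hε : 0 < ε)
    (hsphere : Metric.sphere θ₀ ε ⊆ s) (hpos : ∀ θ ∈ Metric.sphere θ₀ ε, 0 < ⟪F θ, θ - θ₀⟫)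
    (hθ : θ ∈ s) (hzero : F θ = 0) : dist θ θ₀ < ε := by
  by_contra! hle
  rw [dist_eq_norm] at hle
  have hd : 0 < ‖θ - θ₀‖ := hε.trans_le hle
  set x := θ₀ + (ε / ‖θ - θ₀‖) • (θ - θ₀) with hx
  have hx_sub_θ : x - θ = (ε / ‖θ - θ₀‖ - 1) • (θ - θ₀) := by rw [hx]; module
  have hx_sub_θ₀ : x - θ₀ = (ε / ‖θ - θ₀‖) • (θ - θ₀) := add_sub_cancel_left _ _
  have hmem : x ∈ Metric.sphere θ₀ ε := by
    rw [mem_sphere_iff_norm, hx_sub_θ₀, norm_smul, Real.norm_of_nonneg (by positivity),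
      div_mul_cancel₀ _ hd.ne']
  have hradial : 0 < ⟪F x, θ - θ₀⟫ := by
    have h := hpos x hmem
    rw [hx_sub_θ₀, inner_smul_right] at h
    exact pos_of_mul_pos_right h (by positivity)
  have hratio : ε / ‖θ - θ₀‖ = 1 := by
    refine le_antisymm ((div_le_one hd).mpr hle) (sub_nonneg.mp ?_)
    have h := hF.inner_le_inner hθ (hsphere hmem)
    rw [hzero, inner_zero_left, hx_sub_θ, inner_smul_right] at h
    exact nonneg_of_mul_nonneg_left h hradial
  have hxθ : x = θ := by rw [← sub_eq_zero, hx_sub_θ, hratio, sub_self, zero_smul]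
  rw [hxθ, hzero, inner_zero_left] at hradial
  exact lt_irrefl _ hradial

end ThreeCyclicallyMonotoneOn

lemma Model.IsConvexGradient.threeCyclicallyMonotoneOn {d : ℕ} {Θ : Set (Vec d)}
    {F : Vec d → Vec d} (hF : IsConvexGradient Θ F) : ThreeCyclicallyMonotoneOn F Θ := by
  obtain ⟨φ, hφ, hgrad⟩ := hF
  have hsub : ∀ x ∈ Θ, ∀ y ∈ Θ, φ x + ⟪F x, y - x⟫ ≤ φ y := fun x hx y hy => by
    simpa using add_fderiv_le_of_convexOn hφ (hgrad x hx).hasFDerivWithinAt hx hy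
  intro x hx y hy z hz
  linarith [hsub x hx y hy, hsub y hy z hz, hsub z hz x hx]

end Monotone

section ZEstimator

variable {ι : Type*} {𝓕 : Filter ι}

theorem tendsto_zero_of_isCompact {X E : Type*} [TopologicalSpace X] [NormedAddCommGroup E]
    {K : Set X} {x₀ : X} {F : ι → X → E} {G : X → E} {x : ι → X} (hK : IsCompact K)
    (hG : ContinuousOn G K) (hlim : TendstoUniformlyOn F G 𝓕 K)
    (hne : ∀ y ∈ K, y ≠ x₀ → G y ≠ 0) (hx : ∀ᶠ i in 𝓕, x i ∈ K ∧ F i (x i) = 0) :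
    Tendsto x 𝓕 (𝓝 x₀) := by
  refine (nhds_basis_opens x₀).tendsto_right_iff.mpr fun U ⟨hx₀U, hU⟩ => ?_
  obtain ⟨c, hc, hfar⟩ := (hK.diff hU).exists_forall_le' (hG.norm.mono Set.sdiff_subset)
    (fun y hy => norm_pos_iff.mpr (hne y hy.1 (ne_of_mem_of_not_mem hx₀U hy.2).symm))
  filter_upwards [hx, Metric.tendstoUniformlyOn_iff.mp hlim c hc] with i ⟨hmem, hzero⟩ hclose
  by_contra hxU
  have h := hclose _ hmem
  rw [hzero, dist_zero_right] at h
  exact absurd (hfar _ ⟨hmem, hxU⟩) h.not_ge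

theorem tendsto_zero_of_threeCyclicallyMonotoneOn {E : Type*} [NormedAddCommGroup E]
    [InnerProductSpace ℝ E] {Θ K : Set E} {θ₀ : E} {F : ι → E → E} {G : E → E} {θ : ι → E}
    (hK : IsCompact K) (hKΘ : K ⊆ Θ) (hK₀ : K ∈ 𝓝 θ₀)
    (hF : ∀ᶠ i in 𝓕, ThreeCyclicallyMonotoneOn (F i) Θ)
    (hG : ContinuousOn G K) (hlim : TendstoUniformlyOn F G 𝓕 K) (hzero : G θ₀ = 0)
    (hne : ∀ y ∈ K, y ≠ θ₀ → G y ≠ 0) (hθ : ∀ᶠ i in 𝓕, θ i ∈ Θ ∧ F i (θ i) = 0) :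
    Tendsto θ 𝓕 (𝓝 θ₀) := by
  rcases 𝓕.eq_or_neBot with rfl | _
  · exact tendsto_bot
  obtain ⟨ε₁, hε₁, hball⟩ := Metric.nhds_basis_closedBall.mem_iff.mp hK₀
  refine Metric.tendsto_nhds.mpr fun ε₂ hε₂ => ?_
  obtain ⟨ε, hε, hεε₁, hεε₂⟩ : ∃ ε, 0 < ε ∧ ε ≤ ε₁ ∧ ε ≤ ε₂ :=
    ⟨min ε₁ ε₂, lt_min hε₁ hε₂, min_le_left _ _, min_le_right _ _⟩
  have hsphere : Metric.sphere θ₀ ε ⊆ K :=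
    Metric.sphere_subset_closedBall.trans ((Metric.closedBall_subset_closedBall hεε₁).trans hball)
  have hGmono : ThreeCyclicallyMonotoneOn G K :=
    .of_tendsto (hF.mono fun _ h => h.mono hKΘ) fun _ => hlim.tendsto_at
  have hpos : ∀ y ∈ Metric.sphere θ₀ ε, 0 < ⟪G y, y - θ₀⟫ := fun y hy =>
    hGmono.inner_sub_pos hK₀ (hG.continuousAt hK₀) hzero (hsphere hy)
      (hne y (hsphere hy) (Metric.ne_of_mem_sphere hy hε.ne'))
  obtain ⟨c, hc, hle⟩ := (hK.of_isClosed_subset Metric.isClosed_sphere hsphere).exists_forall_le'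
    ((hG.mono hsphere).inner (by fun_prop)) hpos
  filter_upwards [hF, hθ, Metric.tendstoUniformlyOn_iff.mp hlim (c / ε) (by positivity)]
    with i hFi ⟨hmem, hzeroi⟩ hclose
  refine (hFi.dist_lt_of_eq_zero hε (hsphere.trans hKΘ) (fun y hy => ?_) hmem hzeroi).trans_le hεε₂
  have hdiff : ⟪G y - F i y, y - θ₀⟫ < c := by
    refine (real_inner_le_norm _ _).trans_lt ?_
    rw [← dist_eq_norm, mem_sphere_iff_norm.mp hy, ← lt_div_iff₀ hε]
    exact hclose y (hsphere hy)
  rw [inner_sub_left] at hdiff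
  linarith [hle y hy]

end ZEstimator

section HighProb

variable {ι Ω : Type*} [MeasurableSpace Ω] {μ : Measure Ω} {L : Filter ι}

/-- The filter of the sets of pairs `(n, ω)` whose slice at `n` has a complement of measure tending
to zero along `L`: a property holds eventually along it if it holds with probability tending to
one. Limits along it are limits in probability. -/
def highProb (μ : Measure Ω) (L : Filter ι) : Filter (ι × Ω) where
  sets := {s | Tendsto (fun n => μ {ω | (n, ω) ∉ s}) L (𝓝 0)}
  univ_sets := by simpa using tendsto_const_nhds
  sets_of_superset hs hst :=
    tendsto_of_tendsto_of_tendsto_of_le_of_le tendsto_const_nhds hs (fun _ => zero_le)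
      fun _ => measure_mono fun _ hω h => hω (hst h)
  inter_sets {s t} hs ht := by
    refine tendsto_of_tendsto_of_tendsto_of_le_of_le tendsto_const_nhds
      (by simpa only [add_zero] using Tendsto.add hs ht) (fun _ => zero_le) fun n => ?_
    refine (measure_mono fun ω hω => ?_).trans (measure_union_le _ _)
    exact not_and_or.mp hω

lemma eventually_highProb {p : ι × Ω → Prop} :
    (∀ᶠ q in highProb μ L, p q) ↔ Tendsto (fun n => μ {ω | ¬ p (n, ω)}) L (𝓝 0) :=
  Iff.rfl

lemma eventually_highProb_of_ae {p : ι × Ω → Prop} (h : ∀ᶠ n in L, ∀ᵐ ω ∂μ, p (n, ω)) :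
    ∀ᶠ q in highProb μ L, p q :=
  tendsto_const_nhds.congr' (h.mono fun _ hn => (ae_iff.mp hn).symm)

lemma tendsto_fst_highProb : Tendsto Prod.fst (highProb μ L) L := fun _ hs =>
  eventually_highProb_of_ae (Filter.mem_of_superset hs fun _ hn => ae_of_all _ fun _ => hn)

lemma tendsto_prodMap_highProb {κ : Type*} {L' : Filter κ} {N : ι → κ} (hN : Tendsto N L L') :
    Tendsto (Prod.map N id) (highProb μ L) (highProb μ L') := fun s hs =>
  eventually_highProb.mpr (Tendsto.comp (g := fun n => μ {ω | (n, ω) ∉ s}) hs hN)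

lemma tendsto_highProb_zero_iff {Y : ι → Ω → ℝ≥0∞} :
    Tendsto (fun q : ι × Ω => Y q.1 q.2) (highProb μ L) (𝓝 0) ↔
      ∀ ε, 0 < ε → Tendsto (fun n => μ {ω | ε ≤ Y n ω}) L (𝓝 0) := by
  simp only [ENNReal.nhds_zero_basis.tendsto_right_iff, Set.mem_Iio, eventually_highProb, not_lt]

lemma tendstoInMeasure_const_iff {E : Type*} [PseudoEMetricSpace E] {f : ι → Ω → E} {c : E} :
    TendstoInMeasure μ f L (fun _ => c) ↔
      Tendsto (fun q : ι × Ω => f q.1 q.2) (highProb μ L) (𝓝 c) := by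
  rw [tendsto_iff_edist_tendsto_0]
  exact (tendsto_highProb_zero_iff (Y := fun n ω => edist (f n ω) c)).symm

lemma meas_le_measure_compl_add_of_setLIntegral_le {D : Ω → ℝ≥0∞} (hD : AEMeasurable D μ)
    {s : Set Ω} {a η : ℝ≥0∞} (ha : a ≠ 0) (ha' : a ≠ ∞) (h : ∫⁻ ω in s, D ω ∂μ ≤ a * η) :
    μ {ω | a ≤ D ω} ≤ μ sᶜ + η := by
  have hmarkov : μ ({ω | a ≤ D ω} ∩ s) ≤ η :=
    calc μ ({ω | a ≤ D ω} ∩ s) ≤ μ.restrict s {ω | a ≤ D ω} := Measure.le_restrict_apply _ _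
      _ ≤ (∫⁻ ω in s, D ω ∂μ) / a := meas_ge_le_lintegral_div hD.restrict ha ha'
      _ ≤ η := ENNReal.div_le_of_le_mul' h
  calc μ {ω | a ≤ D ω} ≤ μ (sᶜ ∪ ({ω | a ≤ D ω} ∩ s)) := measure_mono fun ω hω =>
        (em (ω ∈ s)).symm.imp id fun hs => ⟨hω, hs⟩
    _ ≤ μ sᶜ + η := (measure_union_le _ _).trans (by gcongr)

lemma tendsto_highProb_zero_of_setLIntegral_le {D : ι → Ω → ℝ≥0∞}
    (hD : ∀ᶠ n in L, AEMeasurable (D n) μ)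
    (h : ∀ ε, 0 < ε → ∃ s ∈ highProb μ L, ∀ᶠ n in L, ∫⁻ ω in {ω | (n, ω) ∈ s}, D n ω ∂μ ≤ ε) :
    Tendsto (fun q : ι × Ω => D q.1 q.2) (highProb μ L) (𝓝 0) := by
  refine tendsto_highProb_zero_iff.mpr fun ε hε => ENNReal.tendsto_nhds_zero.mpr fun η hη => ?_
  set a := min ε 1
  have ha₀ : a ≠ 0 := (lt_min hε one_pos).ne'
  have hη₂ : 0 < η / 2 := ENNReal.half_pos hη.ne'
  obtain ⟨s, hs, hle⟩ := h (a * (η / 2)) (ENNReal.mul_pos ha₀ hη₂.ne')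
  filter_upwards [hD, hle, ENNReal.tendsto_nhds_zero.mp hs _ hη₂] with n hDn hlen hsn
  calc μ {ω | ε ≤ D n ω} ≤ μ {ω | a ≤ D n ω} := measure_mono fun ω hω => (min_le_left ε 1).trans hω
    _ ≤ μ {ω | (n, ω) ∉ s} + η / 2 := meas_le_measure_compl_add_of_setLIntegral_le hDn ha₀
        ((min_le_right ε 1).trans_lt ENNReal.one_lt_top).ne hlen
    _ ≤ η / 2 + η / 2 := by gcongr
    _ = η := ENNReal.add_halves η

end HighProb

section Integral

variable {Ω : Type*} [MeasurableSpace Ω] {μ : Measure Ω}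

lemma exists_measurable_le_of_outerExpect_lt_top {f : Ω → ℝ≥0∞} (hf : outerExpect μ f < ∞) :
    ∃ b : Ω → ℝ≥0∞, Measurable b ∧ f ≤ b ∧ ∫⁻ ω, b ω ∂μ ≠ ∞ := by
  simp only [outerExpect, iInf_lt_iff] at hf
  obtain ⟨b, hb, hle, hfin⟩ := hf
  exact ⟨b, hb, hle, hfin.ne⟩

lemma lintegral_average_le {N : ℕ} {D : Fin N → Ω → ℝ≥0∞} (hD : ∀ t, Measurable (D t)) {ε : ℝ≥0∞}
    (hle : ∀ t, ∫⁻ ω, D t ω ∂μ ≤ ε) : ∫⁻ ω, (N : ℝ≥0∞)⁻¹ * ∑ t, D t ω ∂μ ≤ ε :=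
  calc ∫⁻ ω, (N : ℝ≥0∞)⁻¹ * ∑ t, D t ω ∂μ = (N : ℝ≥0∞)⁻¹ * ∑ t, ∫⁻ ω, D t ω ∂μ := by
        rw [lintegral_const_mul _ (Finset.measurable_fun_sum _ fun t _ => hD t),
          lintegral_finsetSum _ fun t _ => hD t]
    _ ≤ (N : ℝ≥0∞)⁻¹ * ∑ _ : Fin N, ε := by gcongr; exact hle _
    _ = (N : ℝ≥0∞)⁻¹ * N * ε := by simp [mul_assoc]
    _ ≤ ε := mul_le_of_le_one_left zero_le (ENNReal.inv_mul_le_one _)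

lemma setLIntegral_le_of_indepFun [IsProbabilityMeasure μ] {W 𝒵 : Type*} [MeasurableSpace W]
    [MeasurableSpace 𝒵] {D : Ω → W} {ζ : Ω → 𝒵} (hD : Measurable D) (hζ : Measurable ζ)
    (hind : IndepFun D ζ μ) {φ : W × 𝒵 → ℝ≥0∞} (hφ : Measurable φ) (ε : ℝ≥0∞) :
    ∫⁻ ω in {ω | ∫⁻ z, φ (D ω, z) ∂(μ.map ζ) ≤ ε}, φ (D ω, ζ ω) ∂μ ≤ ε := by
  have := Measure.isProbabilityMeasure_map hD.aemeasurable (μ := μ)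
  have := Measure.isProbabilityMeasure_map hζ.aemeasurable (μ := μ)
  set S : Set W := {w | ∫⁻ z, φ (w, z) ∂(μ.map ζ) ≤ ε}
  have hS : MeasurableSet S := measurableSet_le hφ.lintegral_prod_right' measurable_const
  have hpre : {ω | ∫⁻ z, φ (D ω, z) ∂(μ.map ζ) ≤ ε} =
      (fun ω => (D ω, ζ ω)) ⁻¹' (S ×ˢ Set.univ) := by ext; simp [S]
  calc ∫⁻ ω in {ω | ∫⁻ z, φ (D ω, z) ∂(μ.map ζ) ≤ ε}, φ (D ω, ζ ω) ∂μ
      = ∫⁻ q in S ×ˢ Set.univ, φ q ∂((μ.map D).prod (μ.map ζ)) := by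
        rw [← (indepFun_iff_map_prod_eq_prod_map_map hD.aemeasurable hζ.aemeasurable).mp hind, hpre,
          setLIntegral_map (hS.prod .univ) hφ (hD.prodMk hζ)]
    _ = ∫⁻ w in S, ∫⁻ z, φ (w, z) ∂(μ.map ζ) ∂(μ.map D) := by
        rw [← Measure.prod_restrict, Measure.restrict_univ, lintegral_prod _ hφ.aemeasurable]
    _ ≤ ∫⁻ _ in S, ε ∂(μ.map D) := setLIntegral_mono' hS fun _ hw => hw
    _ = ε * μ.map D S := setLIntegral_const _ _
    _ ≤ ε := mul_le_of_le_one_right zero_le prob_le_one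

end Integral

lemma outerExpect_mono {α : Type*} [MeasurableSpace α] {P : Measure α} {f g : α → ℝ≥0∞}
    (hfg : f ≤ g) : outerExpect P f ≤ outerExpect P g :=
  iInf_mono fun _ => iInf_mono fun _ => iInf_mono' fun hg => ⟨fun a => (hfg a).trans (hg a), le_rfl⟩

section ContinuousMap

lemma measurable_of_measurableSet_closedBall {α Y : Type*} [MeasurableSpace α]
    [PseudoMetricSpace Y] [SecondCountableTopology Y] [MeasurableSpace Y] [BorelSpace Y]
    {F : α → Y} (hF : ∀ y, ∀ r : ℝ, MeasurableSet (F ⁻¹' Metric.closedBall y r)) :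
    Measurable F := by
  refine measurable_of_isOpen fun U hU => ?_
  have hball : ∀ y ∈ U, ∃ r : ℝ, 0 < r ∧ Metric.closedBall y r ⊆ U := fun y hy =>
    Metric.nhds_basis_closedBall.mem_iff.mp (hU.mem_nhds hy)
  choose! r hr hsub using hball
  obtain ⟨t, htU, htc, ht⟩ := TopologicalSpace.countable_cover_nhdsWithin
    (f := fun y => Metric.closedBall y (r y))
    fun y hy => mem_nhdsWithin_of_mem_nhds (Metric.closedBall_mem_nhds y (hr y hy))
  have hU_eq : U = ⋃ y ∈ t, Metric.closedBall y (r y) :=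
    ht.antisymm (Set.iUnion₂_subset fun y hy => hsub y (htU hy))
  rw [hU_eq, Set.preimage_iUnion₂]
  exact MeasurableSet.biUnion htc fun y _ => hF y _

lemma measurable_continuousMap {α A E : Type*} [MeasurableSpace α] [TopologicalSpace A]
    [CompactSpace A] [TopologicalSpace.SeparableSpace A] [PseudoMetricSpace E]
    [SecondCountableTopology E] [MeasurableSpace E] [OpensMeasurableSpace E]
    [SecondCountableTopology C(A, E)] [MeasurableSpace C(A, E)] [BorelSpace C(A, E)]
    {F : α → C(A, E)} (hF : ∀ a, Measurable fun x => F x a) : Measurable F := by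
  refine measurable_of_measurableSet_closedBall fun y r => ?_
  rcases lt_or_ge r 0 with hr | hr
  · simp [Metric.closedBall_eq_empty.mpr hr]
  obtain ⟨D, hDc, hD⟩ := TopologicalSpace.exists_countable_dense A
  have hpre : F ⁻¹' Metric.closedBall y r = ⋂ a ∈ D, {x | dist (F x a) (y a) ≤ r} := by
    ext x
    simp only [Set.mem_preimage, Metric.mem_closedBall, Set.mem_iInter, Set.mem_ofPred_eq]
    refine ⟨fun h a _ => (ContinuousMap.dist_le hr).mp h a,
      fun h => (ContinuousMap.dist_le hr).mpr fun a => ?_⟩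
    have hclosed : IsClosed {a | dist (F x a) (y a) ≤ r} :=
      isClosed_le (by fun_prop) continuous_const
    exact (hclosed.closure_subset_iff.mpr fun a ha => h a ha) (hD a)
  rw [hpre]
  exact MeasurableSet.biInter hDc fun a _ =>
    measurableSet_le ((hF a).dist measurable_const) measurable_const

lemma enorm_continuousMap_le {A E : Type*} [TopologicalSpace A] [CompactSpace A]
    [SeminormedAddCommGroup E] {f : C(A, E)} {c : ℝ≥0∞} (hf : ∀ a, ‖f a‖ₑ ≤ c) : ‖f‖ₑ ≤ c := by
  rcases eq_or_ne c ∞ with rfl | hc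
  · exact le_top
  have hnorm : ∀ a, ‖f a‖ ≤ c.toReal := fun a => by
    rw [← ENNReal.ofReal_le_iff_le_toReal hc, ofReal_norm]
    exact hf a
  rw [← ofReal_norm, ENNReal.ofReal_le_iff_le_toReal hc]
  exact (ContinuousMap.norm_le f ENNReal.toReal_nonneg).mpr hnorm

end ContinuousMap

namespace Model

variable {𝒵 𝒳 : Type*} [MeasurableSpace 𝒵] [MeasurableSpace 𝒳] {d l : ℕ} {M : Model 𝒵 𝒳 d l}

section Nuisance

/-- The neighbourhoods of `h₀` in `H` for which `h` tends to `h₀` if and only if the expectations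
`E[∏ᵢ |hᵢ(X) - h₀ᵢ(X)|^{2αᵢ}]` tend to zero for all `α` with `1 ≤ ‖α‖₁ ≤ k + 1`. -/
noncomputable def nuisanceNhds (M : Model 𝒵 𝒳 d l) (k : ℕ) : Filter (𝒳 → Vec l) :=
  𝓟 M.H ⊓ ⨅ (α : Fin l → ℕ) (_ : α ≠ 0) (_ : absIndex α ≤ k + 1), comap (M.nuisanceError 2 α) (𝓝 0)

instance (k : ℕ) : (M.nuisanceNhds k).IsCountablyGenerated := by
  unfold nuisanceNhds
  infer_instance

variable {k : ℕ} {h : 𝒳 → Vec l}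

lemma tendsto_nuisanceNhds {ι : Type*} {𝓕 : Filter ι} {h : ι → 𝒳 → Vec l} :
    Tendsto h 𝓕 (M.nuisanceNhds k) ↔ (∀ᶠ i in 𝓕, h i ∈ M.H) ∧
      ∀ α : Fin l → ℕ, α ≠ 0 → absIndex α ≤ k + 1 →
        Tendsto (fun i => M.nuisanceError 2 α (h i)) 𝓕 (𝓝 0) := by
  simp only [nuisanceNhds, tendsto_inf, tendsto_principal, tendsto_iInf, tendsto_comap_iff,
    Function.comp_def]

lemma finite_absIndex_le (b : ℕ) : {α : Fin l → ℕ | absIndex α ≤ b}.Finite :=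
  (Set.finite_Iic fun _ : Fin l => b).subset fun α hα i =>
    (Finset.single_le_sum (f := α) (fun _ _ => Nat.zero_le _) (Finset.mem_univ i)).trans hα

lemma nuisanceBall_mem_nuisanceNhds {r : ℝ} (hr : 0 < r) :
    M.nuisanceBall k r ∈ M.nuisanceNhds k := by
  obtain ⟨hH, herr⟩ := tendsto_nuisanceNhds.mp (tendsto_id (x := M.nuisanceNhds k))
  have hle : ∀ᶠ h in M.nuisanceNhds k, ∀ α ∈ {α : Fin l → ℕ | absIndex α ≤ k + 1}, α ≠ 0 →
      M.nuisanceError 2 α h ≤ ENNReal.ofReal r :=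
    (eventually_all_finite (finite_absIndex_le _)).mpr fun α hαk =>
      eventually_imp_distrib_left.mpr fun hα =>
        ENNReal.tendsto_nhds_zero.mp (herr α hα hαk) _ (ENNReal.ofReal_pos.mpr hr)
  filter_upwards [hH, hle] with h hh hhle
  exact ⟨hh, fun α hα hαk => hhle α hαk hα⟩

lemma measurable_h₀ : Measurable M.h₀ := M.measurable_H _ M.h₀_mem

lemma h₀_mem_nuisanceBall (k : ℕ) (r : ℝ) : M.h₀ ∈ M.nuisanceBall k r := by
  refine ⟨M.h₀_mem, fun α hα _ => ?_⟩
  obtain ⟨i, hi⟩ := Function.ne_iff.mp hα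
  have hzero : M.nuisanceError 2 α M.h₀ = 0 := by
    refine (lintegral_congr fun z => ?_).trans lintegral_zero
    exact Finset.prod_eq_zero (Finset.mem_univ i) (by simpa using hi)
  exact hzero.trans_le zero_le

lemma nuisanceError_two_le_rpow (hh : Measurable h) (α : Fin l → ℕ) :
    M.nuisanceError 2 α h ≤ M.nuisanceError 4 α h ^ (1 / 2 : ℝ) := by
  have := M.isProb
  have hX := M.measurable_X
  have hh₀ := M.measurable_h₀
  set u : 𝒵 → ℝ≥0∞ := fun z => ∏ i, ‖h (M.X z) i - M.h₀ (M.X z) i‖ₑ ^ (2 * α i)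
  have hu : Measurable u := by fun_prop
  have hfour : M.nuisanceError 4 α h = ∫⁻ z, u z ^ (2 : ℝ) ∂M.P := by
    refine lintegral_congr fun z => ?_
    rw [ENNReal.rpow_two, ← Finset.prod_pow]
    exact Finset.prod_congr rfl fun i _ => by rw [← pow_mul]; congr 1; ring
  have hmono := eLpNorm'_le_eLpNorm'_of_exponent_le one_pos one_le_two M.P hu.aestronglyMeasurable
  rw [hfour]
  simpa only [eLpNorm', enorm_eq_self, ENNReal.rpow_one, div_one] using! hmono

lemma nuisanceError_two_single (i : Fin l) (h : 𝒳 → Vec l) :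
    M.nuisanceError 2 (Pi.single i 1) h = ∫⁻ z, ‖h (M.X z) i - M.h₀ (M.X z) i‖ₑ ^ 2 ∂M.P := by
  refine lintegral_congr fun z => ?_
  rw [Finset.prod_eq_single i (fun j _ hj => by simp [Pi.single_eq_of_ne hj]) (by simp)]
  simp

lemma eLpNorm_two_sub_h₀ (hh : Measurable h) :
    eLpNorm (fun z => h (M.X z) - M.h₀ (M.X z)) 2 M.P =
      (∑ i, M.nuisanceError 2 (Pi.single i 1) h) ^ (1 / 2 : ℝ) := by
  have hX := M.measurable_X
  have hh₀ := M.measurable_h₀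
  have hsq : ∀ v : Vec l, ‖v‖ₑ ^ (2 : ℝ) = ∑ i, ‖v i‖ₑ ^ 2 := fun v => by
    simp only [ENNReal.rpow_two, ← ofReal_norm, ← ENNReal.ofReal_pow (norm_nonneg _),
      ← ENNReal.ofReal_sum_of_nonneg fun i _ => sq_nonneg ‖v i‖, EuclideanSpace.norm_sq_eq]
  simp only [eLpNorm_eq_lintegral_rpow_enorm_toReal two_ne_zero ENNReal.ofNat_ne_top,
    ENNReal.toReal_ofNat, hsq, nuisanceError_two_single, PiLp.sub_apply]
  rw [lintegral_finsetSum]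
  fun_prop

lemma absIndex_single (i : Fin l) : absIndex (Pi.single i 1) = 1 := by
  simp [absIndex]

lemma tendsto_eLpNorm_two_sub_h₀ :
    Tendsto (fun h : 𝒳 → Vec l => eLpNorm (fun z => h (M.X z) - M.h₀ (M.X z)) 2 M.P)
      (M.nuisanceNhds k) (𝓝 0) := by
  obtain ⟨hH, herr⟩ := tendsto_nuisanceNhds.mp (tendsto_id (x := M.nuisanceNhds k))
  have hsum : Tendsto (fun h => ∑ i, M.nuisanceError 2 (Pi.single i 1) h) (M.nuisanceNhds k)
      (𝓝 0) := by
    rw [← Finset.sum_const_zero (ι := Fin l) (s := Finset.univ)]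
    refine tendsto_finsetSum _ fun i _ => herr _ (by simp) ?_
    exact (absIndex_single i).trans_le (Nat.le_add_left 1 k)
  have hrpow := ((ENNReal.continuous_rpow_const (y := 1 / 2)).tendsto' 0 0 (by norm_num)).comp hsum
  exact hrpow.congr' (hH.mono fun h hh => (eLpNorm_two_sub_h₀ (M.measurable_H h hh)).symm)

lemma exists_seq_tendsto_ae_h₀ {h : ℕ → 𝒳 → Vec l} (hh : Tendsto h atTop (M.nuisanceNhds k)) :
    ∃ ms : ℕ → ℕ, Tendsto ms atTop atTop ∧ ∀ᵐ z ∂M.P,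
      Tendsto (fun n => h (ms n) (M.X z)) atTop (𝓝 (M.h₀ (M.X z))) := by
  have hX := M.measurable_X
  obtain ⟨N, hN⟩ := eventually_atTop.mp (tendsto_nuisanceNhds.mp hh).1
  have hmeas : ∀ n, Measurable (h (n + N)) := fun n => M.measurable_H _ (hN _ (Nat.le_add_left N n))
  have hlim : TendstoInMeasure M.P (fun n z => h (n + N) (M.X z)) atTop fun z => M.h₀ (M.X z) :=
    tendstoInMeasure_of_tendsto_eLpNorm two_ne_zero
      (fun n => ((hmeas n).comp hX).aestronglyMeasurable)
      (M.measurable_h₀.comp hX).aestronglyMeasurable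
      (tendsto_eLpNorm_two_sub_h₀.comp (hh.comp (tendsto_add_atTop_nat N)))
  obtain ⟨ns, hns, hae⟩ := hlim.exists_seq_tendsto_ae
  exact ⟨fun n => ns n + N, (tendsto_add_atTop_nat N).comp hns.tendsto_atTop, hae⟩

end Nuisance

section FirstStage

variable {S : Finset (Fin l → ℕ)} {Ω : Type*} [MeasurableSpace Ω]
  {μ : Measure Ω} {L : Filter ℕ} {hhat : ℕ → Ω → 𝒳 → Vec l}

lemma FirstStageAssumptions.tendsto_nuisanceNhds (hfs : M.FirstStageAssumptions S μ L hhat)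
    (hL : L ≤ atTop) (hH : ∀ᶠ n in L, ∀ ω, hhat n ω ∈ M.H) :
    Tendsto (fun q : ℕ × Ω => hhat q.1 q.2) (highProb μ L) (M.nuisanceNhds (maxOrder S)) := by
  have hmem : ∀ᶠ q in highProb μ L, hhat q.1 q.2 ∈ M.H :=
    (tendsto_fst_highProb.eventually hH).mono fun q hq => hq q.2
  refine Model.tendsto_nuisanceNhds.mpr ⟨hmem, fun α hα hαk => ?_⟩
  by_cases hαS : α ∈ S
  · refine tendsto_of_tendsto_of_tendsto_of_le_of_le' tendsto_const_nhds
      (((ENNReal.continuous_rpow_const (y := 1 / 2)).tendsto' 0 0 (by norm_num)).comp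
        (tendsto_highProb_zero_iff.mpr (hfs.consistency α hαS hα)))
      (Eventually.of_forall fun _ => zero_le) (hmem.mono fun q hq => ?_)
    exact nuisanceError_two_le_rpow (M.measurable_H _ hq) α
  · refine tendsto_of_tendsto_of_tendsto_of_le_of_le' tendsto_const_nhds
      (((ENNReal.continuous_pow 2).tendsto' 0 0 (by simp)).comp
        (tendsto_highProb_zero_iff.mpr (hfs.rate α hα hαk hαS)))
      (Eventually.of_forall fun _ => zero_le) ?_
    filter_upwards [tendsto_fst_highProb.eventually (hL (eventually_ge_atTop 1))] with q hq
    have hsq : ∀ x : ℝ≥0∞, (x ^ (1 / 2 : ℝ)) ^ 2 = x := fun x => by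
      rw [← ENNReal.rpow_two, ← ENNReal.rpow_mul]
      norm_num
    rw [Function.comp_apply, mul_pow, hsq, hsq]
    exact le_mul_of_one_le_left zero_le (mod_cast hq)

end FirstStage

section PlugIn

lemma measurable_plugIn {E : Type*} [MeasurableSpace E] {Φ : 𝒵 → Vec l → E}
    (hΦ : Measurable fun q : 𝒵 × Vec l => Φ q.1 q.2) {h : 𝒳 → Vec l} (hh : Measurable h) :
    Measurable fun z => Φ z (h (M.X z)) :=
  hΦ.comp (measurable_id.prodMk (hh.comp M.measurable_X))

variable {E : Type*} [NormedAddCommGroup E] {Φ : 𝒵 → Vec l → E} {k : ℕ}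

/-- The mean error `E‖Φ(Z, h(X)) - Φ(Z, h₀(X))‖` caused by evaluating `Φ` at the nuisance function
`h` in place of `h₀`. -/
noncomputable def plugInError (M : Model 𝒵 𝒳 d l) (Φ : 𝒵 → Vec l → E) (h : 𝒳 → Vec l) : ℝ≥0∞ :=
  ∫⁻ z, ‖Φ z (h (M.X z)) - Φ z (M.h₀ (M.X z))‖ₑ ∂M.P

variable [MeasurableSpace E]

/-- The functions of the data and the nuisance value whose expectation is continuous in the nuisance
function at `h₀`: they are continuous in the nuisance value and dominated, uniformly over a
nuisance ball, by an integrable function of the data. -/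
structure IsDominated (M : Model 𝒵 𝒳 d l) (k : ℕ) (Φ : 𝒵 → Vec l → E) : Prop where
  measurable : Measurable fun q : 𝒵 × Vec l => Φ q.1 q.2
  continuous : ∀ z, Continuous (Φ z)
  dominated : ∃ r : ℝ, 0 < r ∧
    outerExpect M.P (fun z => ⨆ h ∈ M.nuisanceBall k r, ‖Φ z (h (M.X z))‖ₑ) < ∞

namespace IsDominated

lemma exists_majorant (hΦ : M.IsDominated k Φ) :
    ∃ r : ℝ, 0 < r ∧ ∃ b : 𝒵 → ℝ≥0∞, Measurable b ∧ ∫⁻ z, b z ∂M.P ≠ ∞ ∧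
      ∀ h ∈ M.nuisanceBall k r, ∀ z, ‖Φ z (h (M.X z))‖ₑ ≤ b z := by
  obtain ⟨r, hr, hdom⟩ := hΦ.dominated
  obtain ⟨b, hb, hle, hfin⟩ := exists_measurable_le_of_outerExpect_lt_top hdom
  exact ⟨r, hr, b, hb, hfin, fun h hh z =>
    (le_iSup₂_of_le (f := fun h _ => ‖Φ z (h (M.X z))‖ₑ) h hh le_rfl).trans (hle z)⟩

variable [BorelSpace E] [SecondCountableTopology E]

lemma integrable_h₀ (hΦ : M.IsDominated k Φ) : Integrable (fun z => Φ z (M.h₀ (M.X z))) M.P := by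
  obtain ⟨r, -, b, -, hfin, hle⟩ := hΦ.exists_majorant
  exact ⟨(measurable_plugIn hΦ.measurable M.measurable_h₀).aestronglyMeasurable,
    (lintegral_mono (hle _ (M.h₀_mem_nuisanceBall k r))).trans_lt hfin.lt_top⟩

lemma tendsto_plugInError (hΦ : M.IsDominated k Φ) :
    Tendsto (M.plugInError Φ) (M.nuisanceNhds k) (𝓝 0) := by
  obtain ⟨r, hr, b, hb, hfin, hle⟩ := hΦ.exists_majorant
  refine tendsto_of_subseq_tendsto fun h hh => ?_
  obtain ⟨ms, hms, hae⟩ := exists_seq_tendsto_ae_h₀ hh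
  have hball : ∀ᶠ n in atTop, h (ms n) ∈ M.nuisanceBall k r :=
    (hh.comp hms).eventually (nuisanceBall_mem_nuisanceNhds hr)
  refine ⟨ms, ?_⟩
  rw [← lintegral_zero (μ := M.P)]
  refine tendsto_lintegral_filter_of_dominated_convergence (fun z => b z + b z) ?_ ?_ ?_ ?_
  · filter_upwards [hball] with n hn
    exact ((measurable_plugIn hΦ.measurable (M.measurable_H _ hn.1)).sub
      (measurable_plugIn hΦ.measurable M.measurable_h₀)).enorm
  · filter_upwards [hball] with n hn
    exact ae_of_all _ fun z => enorm_sub_le.trans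
      (add_le_add (hle _ hn z) (hle _ (M.h₀_mem_nuisanceBall k r) z))
  · rw [lintegral_add_left hb]
    exact ENNReal.add_ne_top.mpr ⟨hfin, hfin⟩
  · filter_upwards [hae] with z hz
    simpa only [edist_eq_enorm_sub, Function.comp_apply] using
      tendsto_iff_edist_tendsto_0.mp (((hΦ.continuous z).tendsto _).comp hz)

end IsDominated

end PlugIn

section CrossFitting

variable {Ω : Type*} [MeasurableSpace Ω] {μ : Measure Ω}

/-- The nuisance estimate `hhat` is fitted on data independent of the observation `ζ`. -/
def IsFresh (M : Model 𝒵 𝒳 d l) (μ : Measure Ω) (ζ : Ω → 𝒵) (hhat : Ω → 𝒳 → Vec l) : Prop :=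
  ∃ (ι : Type) (g : (ι → 𝒵) → 𝒳 → Vec l) (D : Ω → ι → 𝒵), M.IsProcedure g ∧ Measurable D ∧
    IndepFun D ζ μ ∧ hhat = fun ω => g (D ω)

section Fresh

variable {Z : ℕ → Ω → 𝒵}

lemma IsSample.indepFun_tuple (hZ : M.IsSample μ Z) {ι : Type*} [Finite ι] (e : ι → ℕ) {t : ℕ}
    (ht : ∀ s, e s ≠ t) : IndepFun (fun ω s => Z (e s) ω) (Z t) μ := by
  have := Fintype.ofFinite ι
  have hdisj : Disjoint (Finset.univ.image e) {t} := by
    simp [ht]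
  have hrestrict : Measurable fun (w : (Finset.univ.image e) → 𝒵) (s : ι) =>
      w ⟨e s, Finset.mem_image_of_mem e (Finset.mem_univ s)⟩ := by
    fun_prop
  have heval : Measurable fun w : ({t} : Finset ℕ) → 𝒵 => w ⟨t, Finset.mem_singleton_self t⟩ := by
    fun_prop
  exact (hZ.indep.indepFun_finset _ _ hdisj hZ.measurable).comp hrestrict heval

lemma IsSample.isFresh (hZ : M.IsSample μ Z) {ι : Type} [Finite ι] (e : ι → ℕ) {t : ℕ}
    (ht : ∀ s, e s ≠ t) {g : (ι → 𝒵) → 𝒳 → Vec l} (hg : M.IsProcedure g) :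
    M.IsFresh μ (Z t) (fun ω => g fun s => Z (e s) ω) :=
  ⟨ι, g, fun ω s => Z (e s) ω, hg, measurable_pi_lambda _ fun s => hZ.measurable (e s),
    hZ.indepFun_tuple e ht, rfl⟩

variable {ζ : Ω → 𝒵} {hhat : Ω → 𝒳 → Vec l} {E : Type*} [MeasurableSpace E] {Φ : 𝒵 → Vec l → E}

lemma IsProcedure.measurable_plugIn {ι : Type*} {g : (ι → 𝒵) → 𝒳 → Vec l} (hg : M.IsProcedure g)
    (hΦ : Measurable fun q : 𝒵 × Vec l => Φ q.1 q.2) :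
    Measurable fun q : (ι → 𝒵) × 𝒵 => Φ q.2 (g q.1 (M.X q.2)) :=
  hΦ.comp (measurable_snd.prodMk
    (hg.measurable.comp (measurable_fst.prodMk (M.measurable_X.comp measurable_snd))))

lemma IsFresh.measurable_plugIn (hfresh : M.IsFresh μ ζ hhat) (hζ : Measurable ζ)
    (hΦ : Measurable fun q : 𝒵 × Vec l => Φ q.1 q.2) :
    Measurable fun ω => Φ (ζ ω) (hhat ω (M.X (ζ ω))) := by
  obtain ⟨ι, g, D, hg, hD, -, rfl⟩ := hfresh
  exact (hg.measurable_plugIn hΦ).comp (hD.prodMk hζ)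

lemma IsFresh.setLIntegral_enorm_sub_le {E : Type*} [NormedAddCommGroup E] [MeasurableSpace E]
    [BorelSpace E] [SecondCountableTopology E] [IsProbabilityMeasure μ] {Φ : 𝒵 → Vec l → E}
    (hfresh : M.IsFresh μ ζ hhat) (hζ : Measurable ζ) (hlaw : μ.map ζ = M.P)
    (hΦ : Measurable fun q : 𝒵 × Vec l => Φ q.1 q.2) (ε : ℝ≥0∞) :
    ∫⁻ ω in {ω | M.plugInError Φ (hhat ω) ≤ ε},
      ‖Φ (ζ ω) (hhat ω (M.X (ζ ω))) - Φ (ζ ω) (M.h₀ (M.X (ζ ω)))‖ₑ ∂μ ≤ ε := by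
  obtain ⟨ι, g, D, hg, hD, hind, rfl⟩ := hfresh
  have hdiff : Measurable fun q : (ι → 𝒵) × 𝒵 =>
      ‖Φ q.2 (g q.1 (M.X q.2)) - Φ q.2 (M.h₀ (M.X q.2))‖ₑ :=
    ((hg.measurable_plugIn hΦ).sub
      ((Model.measurable_plugIn hΦ M.measurable_h₀).comp measurable_snd)).enorm
  simpa only [hlaw] using! setLIntegral_le_of_indepFun hD hζ hind hdiff ε

end Fresh

variable {Z : ℕ → Ω → 𝒵} {E : Type*} [NormedAddCommGroup E] [NormedSpace ℝ E]

/-- The average of `Φ(zₜ, h(xₜ))` over a data set `z`, where the nuisance function `h` used for the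
observation `t` is that of the fold to which `t` belongs. -/
noncomputable def plugInMean (M : Model 𝒵 𝒳 d l) (Φ : 𝒵 → Vec l → E) {N : ℕ} {κ : Type*}
    (z : Fin N → 𝒵) (fold : Fin N → κ) (h : κ → 𝒳 → Vec l) : E :=
  (N : ℝ)⁻¹ • ∑ t, Φ (z t) (h (fold t) (M.X (z t)))

lemma edist_plugInMean_le (Φ : 𝒵 → Vec l → E) {N : ℕ} {κ : Type*} (z : Fin N → 𝒵)
    (fold : Fin N → κ) (h h' : κ → 𝒳 → Vec l) :
    edist (M.plugInMean Φ z fold h) (M.plugInMean Φ z fold h') ≤ (N : ℝ≥0∞)⁻¹ *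
      ∑ t, ‖Φ (z t) (h (fold t) (M.X (z t))) - Φ (z t) (h' (fold t) (M.X (z t)))‖ₑ := by
  have hN : ‖(N : ℝ)⁻¹‖ₑ ≤ (N : ℝ≥0∞)⁻¹ := by
    rcases N.eq_zero_or_pos with rfl | hN
    · simp
    · rw [enorm_inv (by positivity), Real.enorm_natCast]
  rw [plugInMean, plugInMean, edist_eq_enorm_sub, ← smul_sub, ← Finset.sum_sub_distrib, enorm_smul]
  exact mul_le_mul' hN (enorm_sum_le _ _)

variable [MeasurableSpace E] [BorelSpace E]

lemma IsSample.tendsto_average [IsProbabilityMeasure μ] [CompleteSpace E]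
    [SecondCountableTopology E] (hZ : M.IsSample μ Z) {Ψ : 𝒵 → E} (hΨ : Measurable Ψ)
    (hint : Integrable Ψ M.P) :
    Tendsto (fun q : ℕ × Ω => (q.1 : ℝ)⁻¹ • ∑ t : Fin q.1, Ψ (Z t q.2)) (highProb μ atTop)
      (𝓝 (∫ z, Ψ z ∂M.P)) := by
  have hlaw : ∀ t, IdentDistrib (Z t) (Z 0) μ μ := fun t =>
    ⟨(hZ.measurable t).aemeasurable, (hZ.measurable 0).aemeasurable, by rw [hZ.law, hZ.law]⟩
  have hint₀ : Integrable (fun ω => Ψ (Z 0 ω)) μ := by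
    rw [← hZ.law 0] at hint
    exact hint.comp_measurable (hZ.measurable 0)
  have hmean : ∫ ω, Ψ (Z 0 ω) ∂μ = ∫ z, Ψ z ∂M.P := by
    rw [← hZ.law 0, integral_map (hZ.measurable 0).aemeasurable hΨ.aestronglyMeasurable]
  have hslln := strong_law_ae (fun t ω => Ψ (Z t ω)) hint₀
    (fun s t hst => (hZ.indep.indepFun hst).comp hΨ hΨ) (fun t => (hlaw t).comp hΨ)
  simp only [hmean, Finset.sum_range] at hslln
  have hmeas : ∀ n : ℕ, Measurable fun ω => ∑ t : Fin n, Ψ (Z t ω) := fun n =>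
    Finset.measurable_fun_sum _ fun t _ => hΨ.comp (hZ.measurable t)
  have hprob := tendstoInMeasure_of_tendsto_ae
    (fun n => (hmeas n).aestronglyMeasurable.const_smul (n : ℝ)⁻¹) hslln
  exact (tendstoInMeasure_const_iff.mp hprob :)

/-- Cross-fitting: at index `n` the observations are `Z 0, …, Z (N n - 1)`, and the nuisance
estimates `hhat j n`, used in the fold `j`, are consistent and fitted on data independent of each
observation of that fold. A single fold with an estimate from further data is sample splitting. -/
structure IsCrossFit (M : Model 𝒵 𝒳 d l) (k : ℕ) (μ : Measure Ω) (Z : ℕ → Ω → 𝒵) {ι κ : Type*}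
    (L : Filter ι) (N : ι → ℕ) (fold : ∀ n, Fin (N n) → κ) (hhat : κ → ι → Ω → 𝒳 → Vec l) :
    Prop where
  tendsto_size : Tendsto N L atTop
  fresh : ∀ᶠ n in L, ∀ t : Fin (N n), M.IsFresh μ (Z t) (hhat (fold n t) n)
  consistent : ∀ j, Tendsto (fun q : ι × Ω => hhat j q.1 q.2) (highProb μ L) (M.nuisanceNhds k)

variable [IsProbabilityMeasure μ] [SecondCountableTopology E] {k : ℕ} {ι κ : Type*} [Finite κ]
  {L : Filter ι} {N : ι → ℕ} {fold : ∀ n, Fin (N n) → κ} {hhat : κ → ι → Ω → 𝒳 → Vec l}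
  {Φ : 𝒵 → Vec l → E}

lemma IsCrossFit.tendsto_edist_plugInMean (hfit : M.IsCrossFit k μ Z L N fold hhat)
    (hZ : M.IsSample μ Z) (hΦ : M.IsDominated k Φ) :
    Tendsto (fun q : ι × Ω =>
      edist (M.plugInMean Φ (fun t => Z t q.2) (fold q.1) (fun j => hhat j q.1 q.2))
        (M.plugInMean Φ (fun t => Z t q.2) (fold q.1) (fun _ => M.h₀)))
      (highProb μ L) (𝓝 0) := by
  refine tendsto_of_tendsto_of_tendsto_of_le_of_le tendsto_const_nhds ?_ (fun _ => zero_le)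
    fun q => edist_plugInMean_le Φ (fun t => Z t q.2) (fold q.1) _ _
  set D : ∀ n, Fin (N n) → Ω → ℝ≥0∞ := fun n t ω =>
    ‖Φ (Z t ω) (hhat (fold n t) n ω (M.X (Z t ω))) - Φ (Z t ω) (M.h₀ (M.X (Z t ω)))‖ₑ
  have hD : ∀ᶠ n in L, ∀ t, Measurable (D n t) := hfit.fresh.mono fun n hn t =>
    (((hn t).measurable_plugIn (hZ.measurable t) hΦ.measurable).sub
      ((measurable_plugIn hΦ.measurable M.measurable_h₀).comp (hZ.measurable t))).enorm
  refine tendsto_highProb_zero_of_setLIntegral_le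
    (D := fun n ω => (N n : ℝ≥0∞)⁻¹ * ∑ t, D n t ω) ?_ fun ε hε => ?_
  · filter_upwards [hD] with n hn
    exact ((Finset.measurable_fun_sum _ fun t _ => hn t).const_mul _).aemeasurable
  set s : Set (ι × Ω) := {q | ∀ j, M.plugInError Φ (hhat j q.1 q.2) ≤ ε}
  have hs : s ∈ highProb μ L := eventually_all.mpr fun j =>
    ENNReal.tendsto_nhds_zero.mp (hΦ.tendsto_plugInError.comp (hfit.consistent j)) ε hε
  refine ⟨s, hs, ?_⟩
  filter_upwards [hD, hfit.fresh] with n hDn hn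
  refine lintegral_average_le hDn fun t => ?_
  exact (lintegral_mono_set fun ω (hω : (n, ω) ∈ s) => hω (fold n t)).trans
    ((hn t).setLIntegral_enorm_sub_le (hZ.measurable t) (hZ.law t) hΦ.measurable ε)

lemma IsCrossFit.tendsto_plugInMean [CompleteSpace E] (hfit : M.IsCrossFit k μ Z L N fold hhat)
    (hZ : M.IsSample μ Z) (hΦ : M.IsDominated k Φ) :
    Tendsto (fun q : ι × Ω =>
      M.plugInMean Φ (fun t => Z t q.2) (fold q.1) (fun j => hhat j q.1 q.2))
      (highProb μ L) (𝓝 (∫ z, Φ z (M.h₀ (M.X z)) ∂M.P)) := by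
  have horacle : Tendsto (fun q : ι × Ω =>
      M.plugInMean Φ (fun t => Z t q.2) (fold q.1) (fun _ => M.h₀)) (highProb μ L)
      (𝓝 (∫ z, Φ z (M.h₀ (M.X z)) ∂M.P)) :=
    (hZ.tendsto_average (measurable_plugIn hΦ.measurable M.measurable_h₀) hΦ.integrable_h₀).comp
      (tendsto_prodMap_highProb hfit.tendsto_size)
  rw [tendsto_iff_edist_tendsto_0] at horacle ⊢
  refine tendsto_of_tendsto_of_tendsto_of_le_of_le tendsto_const_nhds
    (by simpa only [add_zero] using (hfit.tendsto_edist_plugInMean hZ hΦ).add horacle)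
    (fun _ => zero_le) fun q => edist_triangle _ _ _

end CrossFitting

section Moments

/-- The expected moments `E[m(Z, θ, h₀(X))]` as a function of `θ`. -/
noncomputable def populationMoment (M : Model 𝒵 𝒳 d l) (θ : Vec d) : Vec d :=
  ∫ z, M.m z θ (M.h₀ (M.X z)) ∂M.P

lemma populationMoment_θ₀ : M.populationMoment M.θ₀ = 0 := by
  have := M.isProb
  rw [populationMoment, ← integral_condExp M.measurable_X.comap_le,
    integral_congr_ae M.moment_eq_zero]
  simp

/-- The empirical moments as a function of `θ`, with a nuisance function for each fold. -/
noncomputable def empiricalMoment (M : Model 𝒵 𝒳 d l) {N : ℕ} {κ : Type*} (z : Fin N → 𝒵)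
    (fold : Fin N → κ) (h : κ → 𝒳 → Vec l) (θ : Vec d) : Vec d :=
  M.plugInMean (fun z γ => M.m z θ γ) z fold h

/-- The conditions on the moments that are responsible for consistency: `θ₀` is the only zero of
the expected moments, and the moments are continuous and locally dominated. -/
structure ConsistencyConditions (M : Model 𝒵 𝒳 d l) (k : ℕ) : Prop where
  continuous_moment : ∀ z, Continuous fun q : Vec d × Vec l => M.m z q.1 q.2
  identifiable : ∀ θ ∈ M.Θ, θ ≠ M.θ₀ → M.populationMoment θ ≠ 0
  moment_dominated : ∀ A ⊆ M.Θ, IsCompact A → ∃ r : ℝ, 0 < r ∧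
    outerExpect M.P (fun z => ⨆ θ ∈ A, ⨆ h ∈ M.nuisanceBall k r, ‖M.m z θ (h (M.X z))‖ₑ) < ∞

lemma MomentAssumptions.consistencyConditions {S : Finset (Fin l → ℕ)}
    (hM : M.MomentAssumptions S) : M.ConsistencyConditions (maxOrder S) where
  continuous_moment z := (hM.smooth z).continuous
  identifiable := hM.identifiable
  moment_dominated A hAΘ hA :=
    let ⟨r, hr, hreg⟩ := hM.regular
    ⟨r, hr, hreg.moment_dominated A hAΘ hA⟩

/-- The moments at the nuisance value `γ`, as a continuous function of the parameter in `A`. -/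
def momentMap (M : Model 𝒵 𝒳 d l) (hm : ∀ z, Continuous fun q : Vec d × Vec l => M.m z q.1 q.2)
    (A : Set (Vec d)) (z : 𝒵) : C(Vec l, C(A, Vec d)) :=
  ContinuousMap.curry ⟨fun q : Vec l × A => M.m z q.2 q.1,
    (hm z).comp ((continuous_subtype_val.comp continuous_snd).prodMk continuous_fst)⟩

variable {hm : ∀ z, Continuous fun q : Vec d × Vec l => M.m z q.1 q.2} {A : Set (Vec d)} {k : ℕ}

@[simp]
lemma momentMap_apply (z : 𝒵) (γ : Vec l) (θ : A) : M.momentMap hm A z γ θ = M.m z θ γ := rfl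

variable [CompactSpace A]

@[simp]
lemma plugInMean_momentMap_apply {N : ℕ} {κ : Type*} (z : Fin N → 𝒵) (fold : Fin N → κ)
    (h : κ → 𝒳 → Vec l) (θ : A) :
    M.plugInMean (fun z => M.momentMap hm A z) z fold h θ = M.empiricalMoment z fold h θ := by
  simp [plugInMean, empiricalMoment]

variable [MeasurableSpace C(A, Vec d)] [BorelSpace C(A, Vec d)]

lemma isDominated_momentMap {r : ℝ} (hr : 0 < r)
    (hdom : outerExpect M.P (fun z => ⨆ θ ∈ A, ⨆ h ∈ M.nuisanceBall k r,
      ‖M.m z θ (h (M.X z))‖ₑ) < ∞) :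
    M.IsDominated k fun z => M.momentMap hm A z where
  measurable := measurable_continuousMap fun θ => by
    have hpair : Measurable fun q : 𝒵 × Vec l => (q.1, (θ : Vec d), q.2) := by fun_prop
    exact M.measurable_m.comp hpair
  continuous z := (M.momentMap hm A z).continuous
  dominated := by
    refine ⟨r, hr, (outerExpect_mono fun z => iSup₂_le fun h hh => ?_).trans_lt hdom⟩
    refine enorm_continuousMap_le fun θ => ?_
    exact le_iSup₂_of_le (f := fun θ (_ : θ ∈ A) => ⨆ h ∈ M.nuisanceBall k r,
      ‖M.m z θ (h (M.X z))‖ₑ) θ.1 θ.2 (le_iSup₂_of_le h hh le_rfl)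

lemma integral_momentMap_apply (hΦ : M.IsDominated k fun z => M.momentMap hm A z) (θ : A) :
    (∫ z, M.momentMap hm A z (M.h₀ (M.X z)) ∂M.P) θ = M.populationMoment θ :=
  ContinuousMap.integral_apply hΦ.integrable_h₀ θ

end Moments

section Consistency

variable {k : ℕ} {A : Set (Vec d)} {Ω : Type*} [MeasurableSpace Ω] {μ : Measure Ω}
  {Z : ℕ → Ω → 𝒵} {κ : Type*}

lemma ConsistencyConditions.isDominated_momentMap (hM : M.ConsistencyConditions k) (hAΘ : A ⊆ M.Θ)
    [CompactSpace A] [MeasurableSpace C(A, Vec d)] [BorelSpace C(A, Vec d)] :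
    M.IsDominated k fun z => M.momentMap hM.continuous_moment A z :=
  let ⟨_, hr, hdom⟩ := hM.moment_dominated A hAΘ (isCompact_iff_compactSpace.mpr ‹_›)
  Model.isDominated_momentMap hr hdom

lemma ConsistencyConditions.continuousOn_populationMoment (hM : M.ConsistencyConditions k)
    (hAΘ : A ⊆ M.Θ) (hA : IsCompact A) : ContinuousOn M.populationMoment A := by
  have := isCompact_iff_compactSpace.mp hA
  borelize C(A, Vec d)
  refine continuousOn_iff_continuous_domRestrict.mpr ?_
  exact (ContinuousMap.continuous _).congr
    fun θ => integral_momentMap_apply (hM.isDominated_momentMap hAΘ) θ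

variable [IsProbabilityMeasure μ] [Finite κ]

lemma IsCrossFit.tendstoUniformlyOn_empiricalMoment {ι : Type*} {L : Filter ι} {N : ι → ℕ}
    {fold : ∀ n, Fin (N n) → κ} {hhat : κ → ι → Ω → 𝒳 → Vec l}
    (hfit : M.IsCrossFit k μ Z L N fold hhat) (hZ : M.IsSample μ Z)
    (hM : M.ConsistencyConditions k) (hAΘ : A ⊆ M.Θ) (hA : IsCompact A) :
    TendstoUniformlyOn (fun q : ι × Ω =>
      M.empiricalMoment (fun t => Z t q.2) (fold q.1) (fun j => hhat j q.1 q.2))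
      M.populationMoment (highProb μ L) A := by
  have := isCompact_iff_compactSpace.mp hA
  borelize C(A, Vec d)
  have hΦ := hM.isDominated_momentMap hAΘ
  have hlln := ContinuousMap.tendsto_iff_tendstoUniformly.mp (hfit.tendsto_plugInMean hZ hΦ)
  rw [tendstoUniformlyOn_iff_tendstoUniformly_comp_coe]
  convert hlln using 2 with q
  · ext1 θ
    exact (plugInMean_momentMap_apply _ _ _ θ).symm
  · ext1 θ
    exact (integral_momentMap_apply hΦ θ).symm

theorem IsCrossFit.tendstoInMeasure {L : Filter ℕ} {N : ℕ → ℕ} {fold : ∀ n, Fin (N n) → κ}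
    {hhat : κ → ℕ → Ω → 𝒳 → Vec l} (hfit : M.IsCrossFit k μ Z L N fold hhat)
    (hZ : M.IsSample μ Z) (hM : M.ConsistencyConditions k)
    {F : ℕ → Ω → Vec d → Vec d}
    (hF : ∀ n ω, F n ω = M.empiricalMoment (fun t => Z t ω) (fold n) (fun j => hhat j n ω))
    (hCC : M.CompactOrConvex μ L F) {θhat : ℕ → Ω → Vec d}
    (hθhat : ∀ᶠ n in L, ∀ᵐ ω ∂μ, θhat n ω ∈ M.Θ ∧ F n ω (θhat n ω) = 0) :
    TendstoInMeasure μ θhat L (fun _ => M.θ₀) := by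
  have hroot : ∀ᶠ q in highProb μ L, θhat q.1 q.2 ∈ M.Θ ∧ F q.1 q.2 (θhat q.1 q.2) = 0 :=
    eventually_highProb_of_ae hθhat
  have hunif : ∀ A ⊆ M.Θ, IsCompact A → TendstoUniformlyOn (fun q : ℕ × Ω => F q.1 q.2)
      M.populationMoment (highProb μ L) A := fun A hAΘ hA => by
    simpa only [hF] using hfit.tendstoUniformlyOn_empiricalMoment hZ hM hAΘ hA
  refine tendstoInMeasure_const_iff.mpr ?_
  rcases hCC with hΘ | ⟨-, hint, hconv⟩
  · exact tendsto_zero_of_isCompact hΘ (hM.continuousOn_populationMoment subset_rfl hΘ)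
      (hunif _ subset_rfl hΘ) hM.identifiable hroot
  · obtain ⟨A, hA₀, hAΘ, hA⟩ := local_compact_nhds (mem_interior_iff_mem_nhds.mp hint)
    have hgrad : ∀ᶠ q in highProb μ L, IsConvexGradient M.Θ (F q.1 q.2) :=
      eventually_highProb.mpr hconv
    have hmono := hgrad.mono fun q hq => hq.threeCyclicallyMonotoneOn
    exact tendsto_zero_of_threeCyclicallyMonotoneOn hA hAΘ hA₀ hmono
      (hM.continuousOn_populationMoment hAΘ hA) (hunif A hAΘ hA) populationMoment_θ₀
      (fun θ hθ => hM.identifiable θ (hAΘ hθ)) hroot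

end Consistency

section Estimators

variable {Ω : Type*} {Z : ℕ → Ω → 𝒵}

lemma ssMoment_eq (g : ∀ n : ℕ, (Fin n → 𝒵) → 𝒳 → Vec l) (n : ℕ) (ω : Ω) :
    M.ssMoment Z g n ω = M.empiricalMoment (fun t : Fin n => Z t ω) (fun _ => ())
      (fun _ => ssNuisance Z g n ω) := by
  ext1 θ
  rw [ssMoment, empiricalMoment, plugInMean, one_div]

lemma cfMoment_eq {K : ℕ} (fold : ∀ n : ℕ, Fin (2 * n) → Fin K)
    (g : ∀ (n : ℕ) (k : Fin K), ({t : Fin (2 * n) // fold n t ≠ k} → 𝒵) → 𝒳 → Vec l)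
    (n : ℕ) (ω : Ω) :
    M.cfMoment Z fold g n ω = M.empiricalMoment (fun t : Fin (2 * n) => Z t ω) (fold n)
      (fun j => cfNuisance Z fold g j n ω) := by
  ext1 θ
  rw [cfMoment, empiricalMoment, plugInMean, one_div, Nat.cast_mul, Nat.cast_ofNat,
    ← Finset.sum_fiberwise Finset.univ (fold n)]
  refine congrArg _ (Finset.sum_congr rfl fun j _ => Finset.sum_congr rfl fun t ht => ?_)
  rw [(Finset.mem_filter.mp ht).2]

lemma eventually_cfFilter {K : ℕ} : ∀ᶠ n in cfFilter K, 0 < n ∧ K ∣ 2 * n :=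
  ((eventually_gt_atTop 0).filter_mono inf_le_left).and
    (mem_inf_of_right (mem_principal_self _))

variable [MeasurableSpace Ω] {μ : Measure Ω} {k : ℕ}

lemma IsSample.isCrossFit_ssNuisance (hZ : M.IsSample μ Z)
    {g : ∀ n : ℕ, (Fin n → 𝒵) → 𝒳 → Vec l} (hg : ∀ n, M.IsProcedure (g n))
    (hhat : Tendsto (fun q : ℕ × Ω => ssNuisance Z g q.1 q.2) (highProb μ atTop)
      (M.nuisanceNhds k)) :
    M.IsCrossFit k μ Z atTop id (fun _ _ => ()) (fun _ => ssNuisance Z g) where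
  tendsto_size := tendsto_id
  fresh := Eventually.of_forall fun n t =>
    hZ.isFresh (fun s : Fin n => n + s) (fun _ => (Nat.lt_add_right _ t.is_lt).ne') (hg n)
  consistent _ := hhat

lemma IsSample.isCrossFit_cfNuisance (hZ : M.IsSample μ Z) {K : ℕ}
    {fold : ∀ n : ℕ, Fin (2 * n) → Fin K}
    {g : ∀ (n : ℕ) (j : Fin K), ({t : Fin (2 * n) // fold n t ≠ j} → 𝒵) → 𝒳 → Vec l}
    (hg : ∀ n j, K ∣ 2 * n → M.IsProcedure (g n j))
    (hhat : ∀ j, Tendsto (fun q : ℕ × Ω => cfNuisance Z fold g j q.1 q.2)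
      (highProb μ (cfFilter K)) (M.nuisanceNhds k)) :
    M.IsCrossFit k μ Z (cfFilter K) (fun n => 2 * n) fold (cfNuisance Z fold g) where
  tendsto_size := (tendsto_id.const_mul_atTop' two_pos).mono_left inf_le_left
  fresh := eventually_cfFilter.mono fun n hn t =>
    hZ.isFresh (fun s : {s : Fin (2 * n) // fold n s ≠ fold n t} => s.1)
      (fun s hs => s.2 (congrArg (fold n) (Fin.ext hs))) (hg n _ hn.2)
  consistent := hhat

end Estimators

end Model

end OrthogonalML

theorem theorem2_general {𝒵 𝒳 Ω : Type*} [MeasurableSpace 𝒵] [MeasurableSpace 𝒳]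
    [MeasurableSpace Ω] {d l : ℕ} (M : OrthogonalML.Model 𝒵 𝒳 d l) (k : ℕ)
    (hM : M.ConsistencyConditions k)
    (μ : Measure Ω) [IsProbabilityMeasure μ] (Z : ℕ → Ω → 𝒵) (hZ : M.IsSample μ Z) :
    (∀ g : ∀ n : ℕ, (Fin n → 𝒵) → 𝒳 → Vec l,
      (∀ n, M.IsProcedure (g n)) →
      Tendsto (fun q : ℕ × Ω => ssNuisance Z g q.1 q.2) (highProb μ atTop) (M.nuisanceNhds k) →
      M.CompactOrConvex μ atTop (M.ssMoment Z g) →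
      ∀ θhat : ℕ → Ω → Vec d,
        (∀ n, 0 < n → ∀ᵐ ω ∂μ, θhat n ω ∈ M.Θ ∧ M.ssMoment Z g n ω (θhat n ω) = 0) →
        TendstoInMeasure μ θhat atTop (fun _ => M.θ₀)) ∧
    (∀ (K : ℕ) (fold : ∀ n : ℕ, Fin (2 * n) → Fin K)
      (g : ∀ (n : ℕ) (j : Fin K), ({t : Fin (2 * n) // fold n t ≠ j} → 𝒵) → 𝒳 → Vec l),
      (∀ n j, K ∣ 2 * n → M.IsProcedure (g n j)) →
      (∀ j, Tendsto (fun q : ℕ × Ω => cfNuisance Z fold g j q.1 q.2)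
        (highProb μ (cfFilter K)) (M.nuisanceNhds k)) →
      M.CompactOrConvex μ (cfFilter K) (M.cfMoment Z fold g) →
      ∀ θhat : ℕ → Ω → Vec d,
        (∀ n, 0 < n → K ∣ 2 * n →
          ∀ᵐ ω ∂μ, θhat n ω ∈ M.Θ ∧ M.cfMoment Z fold g n ω (θhat n ω) = 0) →
        TendstoInMeasure μ θhat (cfFilter K) (fun _ => M.θ₀)) := by
  constructor
  · intro g hg hhat hCC θhat hθhat
    exact (hZ.isCrossFit_ssNuisance hg hhat).tendstoInMeasure hZ hM (ssMoment_eq g) hCC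
      ((eventually_gt_atTop 0).mono hθhat)
  · intro K fold g hg hhat hCC θhat hθhat
    exact (hZ.isCrossFit_cfNuisance hg hhat).tendstoInMeasure hZ hM (cfMoment_eq fold g) hCC
      (eventually_cfFilter.mono fun n hn => hθhat n hn.1 hn.2)

theorem theorem2 {𝒵 𝒳 Ω : Type*} [MeasurableSpace 𝒵] [MeasurableSpace 𝒳] [MeasurableSpace Ω]
    {d l : ℕ} (M : OrthogonalML.Model 𝒵 𝒳 d l) (S : Finset (Fin l → ℕ))
    (hM : M.MomentAssumptions S)
    (μ : Measure Ω) [IsProbabilityMeasure μ] (Z : ℕ → Ω → 𝒵) (hZ : M.IsSample μ Z) :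
    -- sample splitting
    (∀ g : ∀ n : ℕ, (Fin n → 𝒵) → 𝒳 → Vec l,
      (∀ n, M.IsProcedure (g n)) →
      M.FirstStageAssumptions S μ atTop (ssNuisance Z g) →
      M.CompactOrConvex μ atTop (M.ssMoment Z g) →
      ∀ θhat : ℕ → Ω → Vec d,
        (∀ n, 0 < n → ∀ᵐ ω ∂μ, θhat n ω ∈ M.Θ ∧ M.ssMoment Z g n ω (θhat n ω) = 0) →
        TendstoInMeasure μ θhat atTop (fun _ => M.θ₀)) ∧
    -- cross-fitting
    (∀ K : ℕ, 0 < K → ∀ fold : ∀ n : ℕ, Fin (2 * n) → Fin K, IsFolding fold →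
      ∀ g : ∀ (n : ℕ) (k : Fin K), ({t : Fin (2 * n) // fold n t ≠ k} → 𝒵) → 𝒳 → Vec l,
      (∀ n k, K ∣ 2 * n → M.IsProcedure (g n k)) →
      (∀ k, M.FirstStageAssumptions S μ (cfFilter K) (cfNuisance Z fold g k)) →
      M.CompactOrConvex μ (cfFilter K) (M.cfMoment Z fold g) →
      ∀ θhat : ℕ → Ω → Vec d,
        (∀ n, 0 < n → K ∣ 2 * n →
          ∀ᵐ ω ∂μ, θhat n ω ∈ M.Θ ∧ M.cfMoment Z fold g n ω (θhat n ω) = 0) →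
        TendstoInMeasure μ θhat (cfFilter K) (fun _ => M.θ₀)) := by
  obtain ⟨hss, hcf⟩ := theorem2_general M (maxOrder S) hM.consistencyConditions μ Z hZ
  refine ⟨fun g hg hfs => ?_, fun K _ fold _ g hg hfs => ?_⟩
  · exact hss g hg (hfs.tendsto_nuisanceNhds le_rfl (.of_forall fun n _ => (hg n).mem _))
  · exact hcf K fold g hg fun j => (hfs j).tendsto_nuisanceNhds inf_le_left
      (eventually_cfFilter.mono fun n hn _ => (hg n j hn.2).mem _)
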